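/- Let $I=[0,\infty)$ with Lebesgue measure. Let $V=\mathcal C_0(I)\cap R(I)$ be the real vector space of all continuous functions $f:I\to\mathbb R$ with $\lim_{x\to\infty}f(x)=0$ that are improperly Riemann integrable on $I$ (that is, $\lim_{x\to\infty}\int_0^x f(t)\,dt$ exists and is finite), endowed with the norm $$\|f\|=\sup_{x\ge 0}|f(x)|+\sup_{x\ge 0}\left|\int_0^x f(t)\,dt\right|.$$ Let $A\subset V$ be the set of all $f\in V$ that belong to $L_p(I)$ for no $p\in(0,\infty)$: $$A=\bigl(\mathcal C_0(I)\cap R(I)\bigr)\setminus\bigcup_{p\in(0,\infty)}L_p(I).$$ For cardinals $\alpha,\beta$, a subset $A$ of a topological vector space $E$ is called $(\alpha,\beta)$-spaceable if (i) $E$ has an $\alpha$-dimensional linear subspace $F$ with $F\setminus\{0\}\subset A$, and (ii) for every $\alpha$-dimensional linear subspace $F_\alpha\subset A\cup\{0\}$ of $E$ there is a closed $\beta$-dimensional linear subspace $F_\beta$ of $E$ with $F_\alpha\subset F_\beta\subset A\cup\{0\}$. (Dimension is the cardinality of a Hamel basis.) Then for every cardinal $\alpha$, the set $A$ is $(\alpha,\mathfrak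 c)$-spaceable in $V$ if and only if $\alpha<\aleph_0$, where $\mathfrak c$ is the cardinality of $\mathbb R$. -/

import Mathlib

open Set Filter Topology MeasureTheory
open scoped NNReal ZeroAtInfty Cardinal

universe u v

/-- `A` is `β`-lineable: `F \ {0} ⊆ A` for some linear subspace `F` of (Hamel) dimension `β`. -/
def IsLineable (𝕜 : Type u) {E : Type v} [Field 𝕜] [AddCommGroup E] [Module 𝕜 E]
    (β : Cardinal.{v}) (A : Set E) : Prop :=
  ∃ F : Submodule 𝕜 E, Module.rank 𝕜 F = β ∧ (F : Set E) \ {0} ⊆ A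

/-- `A` is `(α, β)`-spaceable: `A` is `α`-lineable, and every `α`-dimensional linear subspace
contained in `A ∪ {0}` is contained in a closed `β`-dimensional linear subspace contained in
`A ∪ {0}`. -/
def IsSpaceable (𝕜 : Type u) {E : Type v} [Field 𝕜] [AddCommGroup E] [Module 𝕜 E]
    [TopologicalSpace E] (α β : Cardinal.{v}) (A : Set E) : Prop :=
  IsLineable 𝕜 α A ∧
    ∀ Fα : Submodule 𝕜 E, Module.rank 𝕜 Fα = α → (Fα : Set E) ⊆ A ∪ {0} →
      ∃ Fβ : Submodule 𝕜 E, IsClosed (Fβ : Set E) ∧ Module.rank 𝕜 Fβ = β ∧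
        Fα ≤ Fβ ∧ (Fβ : Set E) ⊆ A ∪ {0}

noncomputable section

/-- The integral `∫₀ˣ f(t) dt` of a function `f` on `[0, ∞)`. For continuous `f`, the only case
used, this is also the Riemann integral. -/
def primitiveAt (f : ℝ≥0 → ℝ) (x : ℝ≥0) : ℝ := ∫ t in (0 : ℝ)..x, f t.toNNReal

/-- For continuous `f : [0, ∞) → ℝ` (which is Riemann integrable on each `[0, x]`), improper
Riemann integrability on `[0, ∞)`: `∫₀ˣ f(t) dt` has a finite limit as `x → ∞`. -/
def ImproperlyIntegrable (f : ℝ≥0 → ℝ) : Prop :=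
  ∃ l : ℝ, Tendsto (primitiveAt f) atTop (𝓝 l)

theorem intervalIntegrable_of_zeroAtInfty (f : C₀(ℝ≥0, ℝ)) (a b : ℝ) :
    IntervalIntegrable (fun t : ℝ => f t.toNNReal) volume a b :=
  (f.continuous.comp continuous_real_toNNReal).intervalIntegrable a b

theorem primitiveAt_add (f g : C₀(ℝ≥0, ℝ)) :
    primitiveAt ⇑(f + g) = primitiveAt f + primitiveAt g := by
  funext x
  exact intervalIntegral.integral_add (intervalIntegrable_of_zeroAtInfty f _ _)
    (intervalIntegrable_of_zeroAtInfty g _ _)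

theorem primitiveAt_smul (c : ℝ) (f : C₀(ℝ≥0, ℝ)) :
    primitiveAt ⇑(c • f) = c • primitiveAt f := by
  funext x
  exact intervalIntegral.integral_const_mul c _

/-- The elements of `C₀([0, ∞))` that are improperly Riemann integrable, as a linear subspace. -/
def C0RSubmodule : Submodule ℝ C₀(ℝ≥0, ℝ) where
  carrier := {f | ImproperlyIntegrable f}
  zero_mem' := ⟨0, by
    have : primitiveAt ⇑(0 : C₀(ℝ≥0, ℝ)) = fun _ => 0 := by
      funext x; simp [primitiveAt]
    rw [this]; exact tendsto_const_nhds⟩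
  add_mem' := by
    rintro f g ⟨l, hl⟩ ⟨m, hm⟩
    exact ⟨l + m, by rw [primitiveAt_add]; exact hl.add hm⟩
  smul_mem' := by
    rintro c f ⟨l, hl⟩
    exact ⟨c • l, by rw [primitiveAt_smul]; exact hl.const_smul c⟩

/-- The vector space `C₀(I) ∩ R(I)`, `I = [0, ∞)`; a type of its own, so that it does not inherit
the supremum norm of `C₀(I)`. -/
def C0R : Type := C0RSubmodule

namespace C0R

instance : AddCommGroup C0R := inferInstanceAs (AddCommGroup C0RSubmodule)

instance : Module ℝ C0R := inferInstanceAs (Module ℝ C0RSubmodule)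

/-- The underlying element of `C₀(I)`. -/
def toC0 : C0R →ₗ[ℝ] C₀(ℝ≥0, ℝ) := C0RSubmodule.subtype

theorem toC0_injective : Function.Injective toC0 := Subtype.val_injective

/-- `‖f‖ = sup_{x ≥ 0} |f(x)| + sup_{x ≥ 0} |∫₀ˣ f(t) dt|` -/
instance : Norm C0R where
  norm f := (⨆ x : ℝ≥0, |toC0 f x|) + ⨆ x : ℝ≥0, |primitiveAt (toC0 f) x|

theorem norm_def (f : C0R) :
    ‖f‖ = (⨆ x : ℝ≥0, |toC0 f x|) + ⨆ x : ℝ≥0, |primitiveAt (toC0 f) x| := rfl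

theorem bddAbove_abs (f : C0R) : BddAbove (range fun x : ℝ≥0 => |toC0 f x|) := by
  refine ⟨‖(toC0 f).toBCF‖, ?_⟩
  rintro _ ⟨x, rfl⟩
  exact (toC0 f).toBCF.norm_coe_le_norm x

theorem bddAbove_abs_primitiveAt (f : C0R) :
    BddAbove (range fun x : ℝ≥0 => |primitiveAt (toC0 f) x|) := by
  obtain ⟨l, hl⟩ : ImproperlyIntegrable (toC0 f) := f.2
  obtain ⟨N, hN⟩ := eventually_atTop.1 (hl.abs.eventually (ge_mem_nhds (lt_add_one |l|)))
  have hc : Continuous fun x : ℝ≥0 => |primitiveAt (toC0 f) x| :=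
    ((intervalIntegral.continuous_primitive
      (fun a b => intervalIntegrable_of_zeroAtInfty (toC0 f) a b) 0).comp
        NNReal.continuous_coe).abs
  obtain ⟨M, hM⟩ := (isCompact_Icc (a := (0 : ℝ≥0)) (b := N)).bddAbove_image hc.continuousOn
  refine ⟨max M (|l| + 1), ?_⟩
  rintro _ ⟨x, rfl⟩
  rcases le_total x N with h | h
  · exact (hM ⟨x, ⟨zero_le, h⟩, rfl⟩).trans (le_max_left _ _)
  · exact (hN x h).trans (le_max_right _ _)

theorem normCore : NormedSpace.Core ℝ C0R where
  norm_nonneg f := add_nonneg (Real.iSup_nonneg fun _ => abs_nonneg _)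
    (Real.iSup_nonneg fun _ => abs_nonneg _)
  norm_smul c f := by
    rw [norm_def, norm_def, map_smul, primitiveAt_smul, mul_add,
      Real.mul_iSup_of_nonneg (norm_nonneg c), Real.mul_iSup_of_nonneg (norm_nonneg c)]
    simp [abs_mul]
  norm_triangle f g := by
    rw [norm_def, norm_def, norm_def, map_add, primitiveAt_add, add_add_add_comm]
    refine add_le_add (ciSup_le fun x => ?_) (ciSup_le fun x => ?_)
    · exact (abs_add_le _ _).trans
        (add_le_add (le_ciSup (bddAbove_abs f) x) (le_ciSup (bddAbove_abs g) x))
    · exact (abs_add_le _ _).trans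
        (add_le_add (le_ciSup (bddAbove_abs_primitiveAt f) x)
          (le_ciSup (bddAbove_abs_primitiveAt g) x))
  norm_eq_zero_iff f := by
    constructor
    · intro h
      apply toC0_injective
      ext x
      have h1 : |toC0 f x| ≤ ⨆ x : ℝ≥0, |toC0 f x| := le_ciSup (bddAbove_abs f) x
      have h2 : 0 ≤ ⨆ x : ℝ≥0, |primitiveAt (toC0 f) x| :=
        Real.iSup_nonneg fun _ => abs_nonneg _
      rw [norm_def] at h
      simpa using abs_nonpos_iff.1 (by linarith : |toC0 f x| ≤ 0)
    · rintro rfl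
      simp [norm_def, primitiveAt]

instance : NormedAddCommGroup C0R := NormedAddCommGroup.ofCore normCore

instance : NormedSpace ℝ C0R := NormedSpace.ofCore normCore

/-- The elements of `C₀(I) ∩ R(I)` that belong to `L_p(I)`, where `I = [0, ∞)` carries Lebesgue
measure. -/
def memLp (p : ℝ) : Set C0R :=
  {f | MemLp (fun t : ℝ => toC0 f t.toNNReal) (ENNReal.ofReal p) (volume.restrict (Ici 0))}

end C0R

end

/-! Finite `α`. Let `F` be a finite-dimensional space in `noLp ∪ {0}`, and let `g₀` be sin(2πx) with
amplitude 1/log(n+3) on [n, n+1]; it lies in no `L_p`. The unit sphere of `F` together with `g₀` is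
compact, so [0, ∞) splits into blocks such that every `f` in this set has ∫|f|^(k+1) ≥ 1 over block
`k` (`exists_blocks_of_isCompact`). A function that is bounded by 1 and has this property on
infinitely many blocks lies in no `L_p` (`mem_noLp_of_frequently`).

Even blocks are kept for `F`; odd blocks are divided into infinitely many infinite families. Let `W`
consist of the functions that vanish on even blocks and are a constant multiple of `g₀` on each
family. A nonzero `w ∈ W` agrees, up to a scalar, with `g₀` on some family, and `f + w` agrees with
`f` on even blocks, so `W ⊔ F` stays in `noLp ∪ {0}`. It is closed, since `W` is closed and `F`
finite-dimensional, and its dimension is the continuum (`exists_isClosed_extension`).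

Infinite `α`. On an infinite-dimensional `F` some linear functional `l` equals 1 along a null
sequence. With a nonzero `φ` in every `L_p`, the space of all `y + l y • φ` has the dimension of `F`
and stays in `noLp ∪ {0}`, but `φ` is in its closure (`exists_perturbation`). -/

noncomputable section

/-! ### Pointwise evaluation and membership in `L_p`. -/

namespace C0R

/-- The function `t ↦ f(max(t, 0))` on `ℝ`. -/
def onReal (f : C0R) (t : ℝ) : ℝ := toC0 f t.toNNReal

theorem continuous_onReal (f : C0R) : Continuous (onReal f) :=
  (toC0 f).continuous.comp continuous_real_toNNReal

theorem onReal_add (f g : C0R) (t : ℝ) : onReal (f + g) t = onReal f t + onReal g t := by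
  simp [onReal]

theorem onReal_smul (c : ℝ) (f : C0R) (t : ℝ) : onReal (c • f) t = c * onReal f t := by
  simp [onReal]

theorem ext_onReal {f g : C0R} (h : ∀ t : ℝ, 0 ≤ t → onReal f t = onReal g t) : f = g := by
  apply toC0_injective
  ext x
  simpa [onReal] using h x x.2

theorem abs_toC0_le_norm (f : C0R) (x : ℝ≥0) : |toC0 f x| ≤ ‖f‖ := by
  rw [norm_def]
  exact (le_ciSup (bddAbove_abs f) x).trans
    (le_add_of_nonneg_right (Real.iSup_nonneg fun _ => abs_nonneg _))

theorem abs_onReal_le_norm (f : C0R) (t : ℝ) : |onReal f t| ≤ ‖f‖ := abs_toC0_le_norm f _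

/-- Evaluation at `t` as a linear functional. -/
def evalLM (t : ℝ) : C0R →ₗ[ℝ] ℝ where
  toFun f := onReal f t
  map_add' f g := onReal_add f g t
  map_smul' c f := onReal_smul c f t

theorem continuous_eval (t : ℝ) : Continuous fun f : C0R => onReal f t :=
  (AddMonoidHomClass.continuous_of_bound (evalLM t) 1
    fun f => (abs_onReal_le_norm f t).trans_eq (one_mul _).symm)

theorem continuous_uncurry_onReal : Continuous fun q : C0R × ℝ => onReal q.1 q.2 := by
  rw [continuous_iff_continuousAt]
  rintro ⟨f, t⟩
  rw [ContinuousAt, tendsto_iff_norm_sub_tendsto_zero]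
  have h1 : Tendsto (fun q : C0R × ℝ => ‖q.1 - f‖ + ‖onReal f q.2 - onReal f t‖) (𝓝 (f, t))
      (𝓝 0) := by
    have : Continuous fun q : C0R × ℝ => ‖q.1 - f‖ + ‖onReal f q.2 - onReal f t‖ := by
      have := continuous_onReal f
      fun_prop
    simpa using this.tendsto (f, t)
  refine squeeze_zero (fun _ => norm_nonneg _) (fun q => ?_) h1
  have h2 : onReal q.1 q.2 - onReal f t
      = onReal (q.1 - f) q.2 + (onReal f q.2 - onReal f t) := by
    simp [onReal]
  rw [h2]
  exact (norm_add_le _ _).trans (by gcongr; exact abs_onReal_le_norm _ _)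

/-- The elements of `C₀(I) ∩ R(I)` that belong to no `L_p(I)`. -/
def noLp : Set C0R := (univ : Set C0R) \ ⋃ p ∈ Ioi (0 : ℝ), memLp p

theorem mem_noLp {f : C0R} : f ∈ noLp ↔ ∀ p : ℝ, 0 < p → f ∉ memLp p := by
  simp [noLp]

theorem mem_memLp {f : C0R} {p : ℝ} :
    f ∈ memLp p ↔ MemLp (onReal f) (ENNReal.ofReal p) (volume.restrict (Ici 0)) := Iff.rfl

theorem memLp_iff_integrableOn {f : C0R} {p : ℝ} (hp : 0 < p) :
    f ∈ memLp p ↔ IntegrableOn (fun t => |onReal f t| ^ p) (Ioi 0) := by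
  rw [mem_memLp, ← integrableOn_Ici_iff_integrableOn_Ioi,
    ← integrable_norm_rpow_iff (continuous_onReal f).aestronglyMeasurable
    (by simpa using hp) ENNReal.ofReal_ne_top, ENNReal.toReal_ofReal hp.le]
  rfl

theorem smul_mem_memLp {f : C0R} {p : ℝ} (c : ℝ) (hf : f ∈ memLp p) : c • f ∈ memLp p := by
  rw [mem_memLp] at *
  exact (hf.const_mul c).congr_norm (continuous_onReal _).aestronglyMeasurable
    (ae_of_all _ fun t => by rw [onReal_smul])

theorem smul_mem_noLp {f : C0R} {c : ℝ} (hc : c ≠ 0) (hf : f ∈ noLp) : c • f ∈ noLp := by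
  rw [mem_noLp] at *
  intro p hp h
  have := smul_mem_memLp c⁻¹ h
  rw [smul_smul, inv_mul_cancel₀ hc, one_smul] at this
  exact hf p hp this

theorem sub_mem_memLp {f g : C0R} {p : ℝ} (hf : f ∈ memLp p) (hg : g ∈ memLp p) :
    f - g ∈ memLp p := by
  rw [mem_memLp] at *
  exact (hf.sub hg).congr_norm (continuous_onReal _).aestronglyMeasurable
    (ae_of_all _ fun t => by simp [onReal])

/-! ### Blocks that witness failure of every `L_p`. -/

/-- A function whose `(k+1)`-st powers have integral at least one over infinitely many of the
consecutive blocks `[N k, N (k + 1)]`, where it is bounded by one, is in no `L_p`. -/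
theorem mem_noLp_of_frequently {f : C0R} {N : ℕ → ℕ} (hN : StrictMono N)
    (h : ∃ᶠ k in atTop, (∀ t ∈ Icc (N k : ℝ) (N (k + 1)), |onReal f t| ≤ 1) ∧
      1 ≤ ∫ t in (N k : ℝ)..N (k + 1), |onReal f t| ^ (k + 1)) : f ∈ noLp := by
  rw [mem_noLp]
  intro p hp hf
  rw [memLp_iff_integrableOn hp] at hf
  have hc := continuous_onReal f
  have hcp : Continuous fun t => |onReal f t| ^ p :=
    hc.abs.rpow_const fun _ => Or.inr hp.le
  have hNt : Tendsto (fun k => (N k : ℝ)) atTop atTop :=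
    tendsto_natCast_atTop_atTop.comp hN.tendsto_atTop
  have h1 := intervalIntegral_tendsto_integral_Ioi 0 hf hNt
  -- Block integrals of |f|^p are differences of consecutive terms of a convergent sequence, so they
  -- tend to 0.
  have h2 := (h1.comp (tendsto_add_atTop_nat 1)).sub h1
  rw [sub_self] at h2
  obtain ⟨k, ⟨hk1, hk2⟩, hk3, hk4⟩ :=
    (h.and_eventually ((h2.eventually (gt_mem_nhds one_pos)).and
      (eventually_ge_atTop ⌈p⌉₊))).exists
  simp only [Function.comp_apply] at hk3
  rw [intervalIntegral.integral_interval_sub_left (hcp.intervalIntegrable _ _)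
    (hcp.intervalIntegrable _ _)] at hk3
  refine absurd (hk2.trans ?_) (not_le.2 hk3)
  refine intervalIntegral.integral_mono_on (by exact_mod_cast (hN k.lt_succ_self).le)
    ((hc.abs.pow _).intervalIntegrable _ _) (hcp.intervalIntegrable _ _) fun t ht => ?_
  rw [← Real.rpow_natCast]
  -- Since |f| ≤ 1 on the block, lowering the exponent from k+1 to p ≤ k+1 only increases the
  -- integrand.
  refine Real.rpow_le_rpow_of_exponent_ge_of_imp (abs_nonneg _) (hk1 t ht) ?_ ?_
  · have := (Nat.le_ceil p).trans (Nat.cast_le.2 hk4)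
    push_cast
    linarith
  · intro _ h0
    exact absurd h0 (by positivity)

theorem exists_one_lt_integral {f : C0R} (hf : f ∈ noLp) (k N : ℕ) :
    ∃ M : ℕ, N < M ∧ 1 < ∫ t in (N : ℝ)..M, |onReal f t| ^ (k + 1) := by
  by_contra! h
  have hk : (0 : ℝ) < (k + 1 : ℕ) := by positivity
  refine mem_noLp.1 hf (k + 1 : ℕ) hk ((memLp_iff_integrableOn hk).2 ?_)
  simp only [Real.rpow_natCast]
  have hc : Continuous fun t => |onReal f t| ^ (k + 1) := (continuous_onReal f).abs.pow _
  have h1 : IntegrableOn (fun t => |onReal f t| ^ (k + 1)) (Ioi (N : ℝ)) := by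
    refine integrableOn_Ioi_of_intervalIntegral_norm_bounded (ι := ℕ) (l := atTop)
      (b := fun M => (M : ℝ)) 1 N (fun M => ?_) tendsto_natCast_atTop_atTop ?_
    · exact (hc.continuousOn.integrableOn_Icc).mono_set Ioc_subset_Icc_self
    · filter_upwards [eventually_gt_atTop N] with M hM
      simpa using h M hM
  rw [← Ioc_union_Ioi_eq_Ioi (Nat.cast_nonneg N)]
  exact ((hc.continuousOn.integrableOn_Icc).mono_set Ioc_subset_Icc_self).union h1

/-- A Dini-type argument: the integral is continuous in `f` and increasing in `M`, so the strict
inequalities define an increasing open cover of `K`. -/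
theorem exists_one_le_integral_of_isCompact {K : Set C0R} (hK : IsCompact K) (hA : K ⊆ noLp)
    (k N : ℕ) :
    ∃ M : ℕ, N < M ∧ ∀ f ∈ K, 1 ≤ ∫ t in (N : ℝ)..M, |onReal f t| ^ (k + 1) := by
  have hmono : ∀ f : C0R, ∀ M M' : ℕ, N ≤ M → M ≤ M' →
      ∫ t in (N : ℝ)..M, |onReal f t| ^ (k + 1) ≤ ∫ t in (N : ℝ)..M', |onReal f t| ^ (k + 1) := by
    intro f M M' h h'
    refine intervalIntegral.integral_mono_interval le_rfl (by exact_mod_cast h)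
      (by exact_mod_cast h') (ae_of_all _ fun _ => by positivity)
      (((continuous_onReal f).abs.pow _).intervalIntegrable _ _)
  obtain ⟨M, hM⟩ := hK.elim_directed_cover
    (fun M : ℕ => {f : C0R | 1 < ∫ t in (N : ℝ)..(N + 1 + M : ℕ), |onReal f t| ^ (k + 1)})
    (fun M => isOpen_lt continuous_const
      (intervalIntegral.continuous_parametric_intervalIntegral_of_continuous'
        (continuous_uncurry_onReal.abs.pow _) _ _))
    (fun f hf => by
      obtain ⟨M, h1, h2⟩ := exists_one_lt_integral (hA hf) k N
      exact mem_iUnion.2 ⟨M, h2.trans_le (hmono f _ _ h1.le (by omega))⟩)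
    (Monotone.directed_le fun a b hab f hf =>
      lt_of_lt_of_le hf (hmono f _ _ (by omega) (by omega)))
  exact ⟨N + 1 + M, by omega, fun f hf => (hM hf).le⟩

theorem exists_blocks_of_isCompact {K : Set C0R} (hK : IsCompact K) (hA : K ⊆ noLp) :
    ∃ N : ℕ → ℕ, StrictMono N ∧
      ∀ k, ∀ f ∈ K, 1 ≤ ∫ t in (N k : ℝ)..N (k + 1), |onReal f t| ^ (k + 1) := by
  choose M hM1 hM2 using exists_one_le_integral_of_isCompact hK hA
  exact ⟨fun k => Nat.rec 0 (fun j n => M j n) k,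
    strictMono_nat_of_lt_succ fun k => hM1 _ _, fun k => hM2 _ _⟩

end C0R
end

/-! ### Sine waves with prescribed amplitudes. -/

noncomputable section

/-- The oscillating function `e(⌊x⌋) sin(2πx)`. -/
def waveFun (e : ℕ → ℝ) (x : ℝ) : ℝ := e ⌊x⌋₊ * Real.sin (2 * Real.pi * x)

theorem sin_two_pi_mul_nat (n : ℕ) : Real.sin (2 * Real.pi * n) = 0 := by
  rw [mul_comm (2 * Real.pi)]
  simpa using Real.sin_add_nat_mul_two_pi 0 n

/-- The amplitude jumps only at integers, where the sine vanishes and bounded amplitudes suffice;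
elsewhere it is locally constant. -/
theorem continuous_waveFun {e : ℕ → ℝ} {C : ℝ} (he : ∀ n, |e n| ≤ C) :
    Continuous (waveFun e) := by
  rw [continuous_iff_continuousAt]
  intro x
  have hs : Continuous fun y : ℝ => Real.sin (2 * Real.pi * y) := by fun_prop
  by_cases hx : Real.sin (2 * Real.pi * x) = 0
  · have h0 : waveFun e x = 0 := by simp [waveFun, hx]
    rw [ContinuousAt, h0]
    have h1 : Tendsto (fun y => C * |Real.sin (2 * Real.pi * y)|) (𝓝 x) (𝓝 0) := by
      simpa [hx] using (hs.abs.const_mul C).tendsto x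
    refine squeeze_zero_norm (fun y => ?_) h1
    rw [waveFun, Real.norm_eq_abs, abs_mul]
    exact mul_le_mul_of_nonneg_right (he _) (abs_nonneg _)
  · have hlt : (⌊x⌋ : ℝ) < x := by
      refine lt_of_le_of_ne (Int.floor_le x) fun h => hx ?_
      rw [← h, mul_comm (2 * Real.pi)]
      simpa using Real.sin_add_int_mul_two_pi 0 ⌊x⌋
    have : (fun y => e ⌊x⌋₊ * Real.sin (2 * Real.pi * y)) =ᶠ[𝓝 x] waveFun e := by
      filter_upwards [Ioo_mem_nhds hlt (Int.lt_floor_add_one x)] with y hy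
      have : ⌊y⌋ = ⌊x⌋ := Int.floor_eq_iff.2 ⟨hy.1.le, hy.2⟩
      rw [waveFun, ← Int.floor_toNat, ← Int.floor_toNat, this]
    exact (hs.const_mul _).continuousAt.congr this

theorem waveFun_of_mem_Icc (e : ℕ → ℝ) (n : ℕ) {x : ℝ} (hx : x ∈ Icc (n : ℝ) (n + 1)) :
    waveFun e x = e n * Real.sin (2 * Real.pi * x) := by
  rcases hx.2.eq_or_lt with h | h
  · have := sin_two_pi_mul_nat (n + 1)
    push_cast at this
    rw [waveFun, h, this, mul_zero, mul_zero]
  · rw [waveFun, (Nat.floor_eq_iff ((Nat.cast_nonneg n).trans hx.1)).2 ⟨hx.1, h⟩]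

theorem integral_sin_two_pi_nat (n : ℕ) :
    ∫ x in (n : ℝ)..(n + 1 : ℕ), Real.sin (2 * Real.pi * x) = 0 := by
  rw [intervalIntegral.integral_comp_mul_left _ Real.two_pi_pos.ne', integral_sin]
  have h (m : ℕ) : Real.cos (2 * Real.pi * m) = 1 := by
    rw [mul_comm (2 * Real.pi)]
    simp
  rw [h, h]
  simp

theorem integral_waveFun_nat (e : ℕ → ℝ) (n : ℕ) :
    ∫ x in (n : ℝ)..(n + 1 : ℕ), waveFun e x = 0 := by
  have : ∫ x in (n : ℝ)..(n + 1 : ℕ), waveFun e x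
      = ∫ x in (n : ℝ)..(n + 1 : ℕ), e n * Real.sin (2 * Real.pi * x) := by
    refine intervalIntegral.integral_congr fun x hx => waveFun_of_mem_Icc e n ?_
    simpa [uIcc_of_le] using hx
  rw [this, intervalIntegral.integral_const_mul, integral_sin_two_pi_nat, mul_zero]

/-- Full periods integrate to zero; what remains is a piece of length at most 1 with amplitude `e
⌊x⌋₊`. -/
theorem abs_integral_waveFun_le {e : ℕ → ℝ} {C : ℝ} (he : ∀ n, |e n| ≤ C) {x : ℝ} (hx : 0 ≤ x) :
    |∫ t in (0 : ℝ)..x, waveFun e t| ≤ |e ⌊x⌋₊| := by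
  have hi (a b : ℝ) : IntervalIntegrable (waveFun e) volume a b :=
    (continuous_waveFun he).intervalIntegrable a b
  have h0 : ∫ t in (0 : ℝ)..⌊x⌋₊, waveFun e t = 0 := by
    have := intervalIntegral.sum_integral_adjacent_intervals (μ := volume) (f := waveFun e)
      (a := fun n : ℕ => (n : ℝ)) (n := ⌊x⌋₊) fun k _ => hi _ _
    rw [Finset.sum_eq_zero fun k _ => integral_waveFun_nat e k] at this
    simpa using this.symm
  rw [← intervalIntegral.integral_add_adjacent_intervals (hi 0 ⌊x⌋₊) (hi _ x), h0, zero_add]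
  have hf := Nat.floor_le hx
  have hf' := (Nat.lt_floor_add_one x).le
  have := intervalIntegral.norm_integral_le_of_norm_le_const (a := (⌊x⌋₊ : ℝ)) (b := x)
    (f := waveFun e) (C := |e ⌊x⌋₊|) fun t ht => by
      rw [uIoc_of_le hf] at ht
      rw [waveFun_of_mem_Icc e ⌊x⌋₊ ⟨ht.1.le, ht.2.trans hf'⟩, norm_mul]
      exact mul_le_of_le_one_right (norm_nonneg _) (Real.abs_sin_le_one _)
  refine this.trans (mul_le_of_le_one_right (abs_nonneg _) ?_)
  rw [abs_of_nonneg (by linarith)]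
  linarith

theorem exists_abs_le_of_tendsto_zero {e : ℕ → ℝ} (he : Tendsto e atTop (𝓝 0)) :
    ∃ C, ∀ n, |e n| ≤ C := by
  obtain ⟨C, hC⟩ := he.abs.bddAbove_range
  exact ⟨C, fun n => hC ⟨n, rfl⟩⟩

namespace C0R

theorem tendsto_floor_coe : Tendsto (fun x : ℝ≥0 => ⌊(x : ℝ)⌋₊) atTop atTop :=
  tendsto_nat_floor_atTop.comp (NNReal.tendsto_coe_atTop.2 tendsto_id)

theorem exists_wave {e : ℕ → ℝ} (he : Tendsto e atTop (𝓝 0)) :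
    ∃ f : C0R, ∀ t : ℝ, 0 ≤ t → onReal f t = waveFun e t := by
  obtain ⟨C, hC⟩ := exists_abs_le_of_tendsto_zero he
  have hlim : Tendsto (fun x : ℝ≥0 => |e ⌊(x : ℝ)⌋₊|) atTop (𝓝 0) := by
    simpa using (he.comp tendsto_floor_coe).abs
  let g : C₀(ℝ≥0, ℝ) :=
    { toFun := fun x => waveFun e x
      continuous_toFun := (continuous_waveFun hC).comp NNReal.continuous_coe
      zero_at_infty' := by
        rw [cocompact_eq_atTop]
        refine squeeze_zero_norm (fun x => ?_) hlim
        rw [waveFun, norm_mul]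
        exact mul_le_of_le_one_right (norm_nonneg _) (Real.abs_sin_le_one _) }
  have hg (t : ℝ) (ht : 0 ≤ t) : g t.toNNReal = waveFun e t := by
    change waveFun e (t.toNNReal : ℝ) = _
    rw [Real.coe_toNNReal t ht]
  refine ⟨⟨g, 0, squeeze_zero_norm (fun x => ?_) hlim⟩, hg⟩
  have : primitiveAt g x = ∫ t in (0 : ℝ)..x, waveFun e t := by
    refine intervalIntegral.integral_congr fun t ht => hg t ?_
    rw [uIcc_of_le (NNReal.coe_nonneg x)] at ht
    exact ht.1
  rw [this]
  exact abs_integral_waveFun_le hC x.2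

/-- The element `e(⌊x⌋) sin(2πx)` of `C₀(I) ∩ R(I)`, for a null sequence `e`. -/
def wave {e : ℕ → ℝ} (he : Tendsto e atTop (𝓝 0)) : C0R := (exists_wave he).choose

theorem onReal_wave {e : ℕ → ℝ} (he : Tendsto e atTop (𝓝 0)) {t : ℝ} (ht : 0 ≤ t) :
    onReal (wave he) t = waveFun e t := (exists_wave he).choose_spec t ht

theorem integral_abs_sin_rpow_pos {p : ℝ} (hp : 0 < p) :
    0 < ∫ x in (0 : ℝ)..1, |Real.sin (2 * Real.pi * x)| ^ p := by
  have hc : Continuous fun x : ℝ => |Real.sin (2 * Real.pi * x)| ^ p :=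
    Continuous.rpow_const (by fun_prop) fun _ => Or.inr hp.le
  refine intervalIntegral.integral_pos one_pos hc.continuousOn
    (fun x _ => by positivity) ⟨1 / 4, by norm_num, ?_⟩
  rw [show 2 * Real.pi * (1 / 4) = Real.pi / 2 by ring]
  simp

theorem integral_abs_wave_rpow {e : ℕ → ℝ} (he : Tendsto e atTop (𝓝 0)) (p : ℝ) (n : ℕ) :
    ∫ t in (n : ℝ)..(n + 1 : ℕ), |onReal (wave he) t| ^ p
      = |e n| ^ p * ∫ x in (0 : ℝ)..1, |Real.sin (2 * Real.pi * x)| ^ p := by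
  have h1 : ∫ t in (n : ℝ)..(n + 1 : ℕ), |onReal (wave he) t| ^ p
      = ∫ t in (n : ℝ)..(n + 1 : ℕ), |e n| ^ p * |Real.sin (2 * Real.pi * t)| ^ p := by
    refine intervalIntegral.integral_congr fun x hx => ?_
    have hx' : x ∈ Icc (n : ℝ) (n + 1) := by simpa [uIcc_of_le] using hx
    rw [onReal_wave he ((Nat.cast_nonneg n).trans hx'.1), waveFun_of_mem_Icc e n hx', abs_mul,
      Real.mul_rpow (abs_nonneg _) (abs_nonneg _)]
  rw [h1, intervalIntegral.integral_const_mul]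
  congr 1
  have h2 := intervalIntegral.integral_comp_add_right (a := 0) (b := 1)
    (fun t => |Real.sin (2 * Real.pi * t)| ^ p) (n : ℝ)
  rw [zero_add, add_comm (1 : ℝ)] at h2
  push_cast
  rw [← h2]
  refine intervalIntegral.integral_congr fun x _ => ?_
  rw [mul_add, mul_comm (2 * Real.pi) (n : ℝ), Real.sin_add_nat_mul_two_pi]

theorem sum_integral_abs_wave_rpow {e : ℕ → ℝ} (he : Tendsto e atTop (𝓝 0)) {p : ℝ} (hp : 0 < p)
    (n : ℕ) :
    ∫ t in (0 : ℝ)..n, |onReal (wave he) t| ^ p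
      = (∑ j ∈ Finset.range n, |e j| ^ p) *
        ∫ x in (0 : ℝ)..1, |Real.sin (2 * Real.pi * x)| ^ p := by
  have hc : Continuous fun t => |onReal (wave he) t| ^ p :=
    (continuous_onReal _).abs.rpow_const fun _ => Or.inr hp.le
  have := intervalIntegral.sum_integral_adjacent_intervals (μ := volume)
    (f := fun t => |onReal (wave he) t| ^ p)
    (a := fun n : ℕ => (n : ℝ)) (n := n) fun k _ => hc.intervalIntegrable _ _
  rw [Nat.cast_zero] at this
  rw [← this, Finset.sum_mul]
  exact Finset.sum_congr rfl fun j _ => integral_abs_wave_rpow he p j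

/-- Each unit interval contributes |e n|^p times one fixed positive constant. -/
theorem wave_mem_memLp_iff {e : ℕ → ℝ} (he : Tendsto e atTop (𝓝 0)) {p : ℝ} (hp : 0 < p) :
    wave he ∈ memLp p ↔ Summable fun n => |e n| ^ p := by
  have hc : Continuous fun t => |onReal (wave he) t| ^ p :=
    (continuous_onReal _).abs.rpow_const fun _ => Or.inr hp.le
  have hγ := integral_abs_sin_rpow_pos hp
  rw [memLp_iff_integrableOn hp]
  constructor
  · intro h
    have h1 := intervalIntegral_tendsto_integral_Ioi 0 h
      (tendsto_natCast_atTop_atTop (R := ℝ))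
    simp only [sum_integral_abs_wave_rpow he hp] at h1
    have h2 := h1.div_const (∫ x in (0 : ℝ)..1, |Real.sin (2 * Real.pi * x)| ^ p)
    simp only [mul_div_cancel_right₀ _ hγ.ne'] at h2
    exact ((hasSum_iff_tendsto_nat_of_nonneg (fun n => by positivity) _).2 h2).summable
  · intro h
    refine integrableOn_Ioi_of_intervalIntegral_norm_bounded (ι := ℕ) (l := atTop)
      (b := fun M => (M : ℝ))
      ((∑' n, |e n| ^ p) * ∫ x in (0 : ℝ)..1, |Real.sin (2 * Real.pi * x)| ^ p) 0
      (fun M => ?_) tendsto_natCast_atTop_atTop (Eventually.of_forall fun n => ?_)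
    · exact (hc.continuousOn.integrableOn_Icc).mono_set Ioc_subset_Icc_self
    · have h3 (t : ℝ) : ‖|onReal (wave he) t| ^ p‖ = |onReal (wave he) t| ^ p :=
        Real.norm_of_nonneg (by positivity)
      simp only [h3]
      rw [sum_integral_abs_wave_rpow he hp]
      exact mul_le_mul_of_nonneg_right
        (h.sum_le_tsum _ fun _ _ => by positivity) hγ.le

theorem tendsto_inv_log : Tendsto (fun n : ℕ => (Real.log (n + 3))⁻¹) atTop (𝓝 0) :=
  (Real.tendsto_log_atTop.comp
    (tendsto_atTop_add_const_right _ 3 tendsto_natCast_atTop_atTop)).inv_tendsto_atTop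

/-- Any power of log n is O(n), so summability of the p-th powers would make the harmonic series
converge. -/
theorem wave_inv_log_mem_noLp : wave tendsto_inv_log ∈ noLp := by
  rw [mem_noLp]
  intro p hp h
  rw [wave_mem_memLp_iff tendsto_inv_log hp] at h
  have h1 : (fun n : ℕ => ((n : ℝ) + 3)⁻¹) =O[atTop]
      fun n : ℕ => |(Real.log (n + 3))⁻¹| ^ p := by
    have h2 := ((isLittleO_log_rpow_rpow_atTop p one_pos).comp_tendsto
      (tendsto_atTop_add_const_right _ 3 (tendsto_natCast_atTop_atTop (R := ℝ)))).isBigO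
    have hpos (n : ℕ) : 0 < Real.log ((n : ℝ) + 3) := Real.log_pos (by
      have : (0 : ℝ) ≤ n := Nat.cast_nonneg n
      linarith)
    have h3 := h2.inv_rev (Eventually.of_forall fun n hn =>
      absurd hn (Real.rpow_pos_of_pos (hpos n) p).ne')
    refine h3.congr (fun n => by simp) fun n => ?_
    rw [abs_of_pos (inv_pos.2 (hpos n)), Real.inv_rpow (hpos n).le]
    rfl
  have h4 := summable_of_isBigO_nat h h1
  refine Real.not_summable_natCast_inv ((summable_nat_add_iff 3).1 ?_)
  simpa using h4

end C0R
end

/-! ### Dimension counts and the closed extension of a finite-dimensional space. -/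

noncomputable section

theorem waveFun_natCast (e : ℕ → ℝ) (n : ℕ) : waveFun e n = 0 := by
  rw [waveFun, sin_two_pi_mul_nat, mul_zero]

theorem waveFun_add_quarter (e : ℕ → ℝ) (n : ℕ) : waveFun e (n + 1 / 4) = e n := by
  rw [waveFun_of_mem_Icc e n ⟨by linarith, by linarith⟩, mul_add,
    mul_comm (2 * Real.pi) (n : ℝ), add_comm, Real.sin_add_nat_mul_two_pi,
    show 2 * Real.pi * (1 / 4) = Real.pi / 2 by ring, Real.sin_pi_div_two, mul_one]

/-- Dedekind's independence of characters, applied to the homomorphisms n ↦ t^n. -/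
theorem linearIndependent_powers (S : Set ℝ) :
    LinearIndependent ℝ fun t : S => fun n : Multiplicative ℕ => (t : ℝ) ^ n.toAdd := by
  have h := (linearIndependent_monoidHom (Multiplicative ℕ) ℝ).comp
    (fun t : S => powersHom ℝ (t : ℝ)) fun s t h =>
      Subtype.ext ((powersHom ℝ).injective h)
  exact h

theorem exists_submodule_rank_eq {K V : Type*} [Field K] [AddCommGroup V] [Module K V]
    (G : Submodule K V) {c : Cardinal} (hc : c ≤ Module.rank K G) :
    ∃ F ≤ G, Module.rank K F = c := by
  obtain ⟨s, rfl, hs⟩ := le_rank_iff_exists_linearIndependent.1 hc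
  have hs' : LinearIndependent K fun x : s => (x : G) := hs
  have hl : LinearIndependent K fun x : s => ((x : G) : V) :=
    hs'.map' G.subtype (Submodule.ker_subtype G)
  refine ⟨Submodule.span K (range fun x : s => ((x : G) : V)), ?_, ?_⟩
  · rw [Submodule.span_le]
    rintro _ ⟨x, rfl⟩
    exact x.1.2
  · rw [rank_span hl, Cardinal.mk_range_eq _ hl.injective]

/-- There is a function sending each `j ∈ [N k, N (k + 1))` to the block index `k`. -/
theorem exists_blockIndex {N : ℕ → ℕ} (hN : StrictMono N) :
    ∃ κ : ℕ → ℕ, ∀ k j, N k ≤ j → j < N (k + 1) → κ j = k := by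
  have h (j : ℕ) : ∃ k, j < N (k + 1) := ⟨j, (Nat.lt_succ_self j).trans_le (hN.id_le _)⟩
  refine ⟨fun j => Nat.find (h j), fun k j h1 h2 => ?_⟩
  rw [Nat.find_eq_iff]
  exact ⟨h2, fun m hm => not_lt.2 ((hN.monotone hm).trans h1)⟩

namespace C0R

/-- A continuous function is determined by its values at rationals. -/
theorem rank_le_continuum : Module.rank ℝ C0R ≤ Cardinal.continuum := by
  refine (rank_le_card ℝ C0R).trans ?_
  have hinj : Function.Injective fun (f : C0R) (q : ℚ) => onReal f q := fun f g h => by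
    have := (continuous_onReal f).ext_on Rat.denseRange_cast (continuous_onReal g)
      (by rintro _ ⟨q, rfl⟩; exact congrFun h q)
    exact ext_onReal fun t _ => congrFun this t
  refine (Cardinal.mk_le_of_injective hinj).trans ?_
  simp [Cardinal.mk_real]

/-- The functions `w` that are proportional to `g` on each fibre of `x ↦ ν ⌊x⌋`. -/
def blockProportional (ν : ℕ → ℕ) (g : C0R) : Submodule ℝ C0R where
  -- The cross-multiplied form is linear in `w`, preserved by pointwise limits, and free of division
  -- by `g`.
  carrier := {w | ∀ x y : ℝ, 0 ≤ x → 0 ≤ y → ν ⌊x⌋₊ = ν ⌊y⌋₊ →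
    onReal w x * onReal g y = onReal w y * onReal g x}
  zero_mem' := by simp [onReal]
  add_mem' := by
    intro v w hv hw x y hx hy h
    rw [onReal_add, onReal_add, add_mul, add_mul, hv x y hx hy h, hw x y hx hy h]
  smul_mem' := by
    intro c w hw x y hx hy h
    rw [onReal_smul, onReal_smul, mul_assoc, mul_assoc, hw x y hx hy h]

theorem isClosed_blockProportional (ν : ℕ → ℕ) (g : C0R) :
    IsClosed (blockProportional ν g : Set C0R) := by
  change IsClosed {w : C0R | ∀ x y : ℝ, 0 ≤ x → 0 ≤ y → ν ⌊x⌋₊ = ν ⌊y⌋₊ →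
    onReal w x * onReal g y = onReal w y * onReal g x}
  simp only [ofPred_forall]
  exact isClosed_iInter fun x => isClosed_iInter fun y => isClosed_iInter fun _ =>
    isClosed_iInter fun _ => isClosed_iInter fun _ =>
      isClosed_eq ((continuous_eval x).mul_const _) ((continuous_eval y).mul_const _)

theorem continuum_le_rank_blockProportional {ν : ℕ → ℕ} {e : ℕ → ℝ}
    (he : Tendsto e atTop (𝓝 0)) (hν : ∀ n, ∃ j, ν j = n ∧ e j ≠ 0) :
    Cardinal.continuum ≤ Module.rank ℝ (blockProportional ν (wave he)) := by
  choose j hj1 hj2 using hν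
  have ha (t : Icc (0 : ℝ) 1) : Tendsto (fun i => (t : ℝ) ^ ν i * e i) atTop (𝓝 0) := by
    refine squeeze_zero_norm (fun i => ?_) (by simpa using he.abs)
    rw [norm_mul]
    refine mul_le_of_le_one_left (norm_nonneg _) ?_
    rw [norm_pow, Real.norm_of_nonneg t.2.1]
    exact pow_le_one₀ t.2.1 t.2.2
  let T (t : Icc (0 : ℝ) 1) : blockProportional ν (wave he) := ⟨wave (ha t), by
    intro x y hx hy h
    rw [onReal_wave _ hx, onReal_wave _ hx, onReal_wave _ hy, onReal_wave _ hy]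
    simp only [waveFun, h]
    ring⟩
  -- Sampling at the peak j + 1/4 of a hump in fibre n and dividing by its amplitude recovers t^n.
  let L : blockProportional ν (wave he) →ₗ[ℝ] (Multiplicative ℕ → ℝ) :=
    LinearMap.pi fun n => ((e (j n.toAdd))⁻¹ • evalLM (j n.toAdd + 1 / 4)).comp
      (blockProportional ν (wave he)).subtype
  have hL : LinearIndependent ℝ T := by
    refine LinearIndependent.of_comp L ?_
    have : L ∘ T = fun (t : Icc (0 : ℝ) 1) (n : Multiplicative ℕ) => (t : ℝ) ^ n.toAdd := by
      funext t n
      change (e (j n.toAdd))⁻¹ * onReal (wave (ha t)) (j n.toAdd + 1 / 4) = _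
      rw [onReal_wave _ (by positivity), waveFun_add_quarter, hj1, mul_left_comm,
        inv_mul_cancel₀ (hj2 _), mul_one]
    rw [this]
    exact linearIndependent_powers _
  have := hL.cardinal_le_rank
  rwa [Cardinal.mk_Icc_real one_pos] at this

theorem abs_onReal_wave_inv_log_le {t : ℝ} (ht : 0 ≤ t) :
    |onReal (wave tendsto_inv_log) t| ≤ 1 := by
  rw [onReal_wave _ ht, waveFun, abs_mul]
  refine mul_le_one₀ ?_ (abs_nonneg _) (Real.abs_sin_le_one _)
  -- The shift by 3 > exp 1 makes every amplitude at most 1.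
  have h : 1 ≤ Real.log (⌊t⌋₊ + 3) := by
    rw [Real.le_log_iff_exp_le (by positivity)]
    have := Real.exp_one_lt_d9
    have : (0 : ℝ) ≤ ⌊t⌋₊ := Nat.cast_nonneg _
    linarith
  rw [abs_of_nonneg (by positivity)]
  exact inv_le_one_of_one_le₀ h

/-- A finite-dimensional space of functions lying in no `L_p` extends to a closed space of
dimension at least the continuum of such functions. -/
theorem exists_isClosed_extension (F : Submodule ℝ C0R) [FiniteDimensional ℝ F]
    (hF : (F : Set C0R) ⊆ noLp ∪ {0}) :
    ∃ G : Submodule ℝ C0R, IsClosed (G : Set C0R) ∧ Cardinal.continuum ≤ Module.rank ℝ G ∧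
      F ≤ G ∧ (G : Set C0R) ⊆ noLp ∪ {0} := by
  set g₀ := wave tendsto_inv_log with hg₀
  have hK : IsCompact (F.subtype '' Metric.sphere 0 1 ∪ {g₀}) :=
    ((isCompact_sphere (0 : F) 1).image F.subtypeL.continuous).union isCompact_singleton
  have hKA : F.subtype '' Metric.sphere 0 1 ∪ {g₀} ⊆ noLp := by
    rintro _ (⟨x, hx, rfl⟩ | rfl)
    · refine (hF x.2).resolve_right fun h => ?_
      have h0 : x = 0 := Subtype.ext h
      simp [h0] at hx
    · exact wave_inv_log_mem_noLp
  obtain ⟨N, hN, hNK⟩ := exists_blocks_of_isCompact hK hKA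
  obtain ⟨κ, hκ⟩ := exists_blockIndex hN
  -- The first coordinate of the pairing names the family; the second runs through its infinitely
  -- many blocks.
  let ν : ℕ → ℕ := fun j => (Nat.unpair (κ j / 2)).1
  let e : ℕ → ℝ := fun j => if Odd (κ j) then (Real.log (j + 3))⁻¹ else 0
  have he : Tendsto e atTop (𝓝 0) := by
    refine squeeze_zero_norm (fun j => ?_) (by simpa using tendsto_inv_log.abs)
    by_cases h : Odd (κ j) <;> simp [e, h]
  have hνe (n : ℕ) : ∃ j, ν j = n ∧ e j ≠ 0 := by
    have h1 : κ (N (2 * Nat.pair n 0 + 1)) = 2 * Nat.pair n 0 + 1 :=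
      hκ _ _ le_rfl (hN (Nat.lt_succ_self _))
    refine ⟨N (2 * Nat.pair n 0 + 1), ?_, ?_⟩
    · simp only [ν]
      rw [h1, show (2 * Nat.pair n 0 + 1) / 2 = Nat.pair n 0 by omega, Nat.unpair_pair]
    · simp only [e]
      rw [h1, if_pos (odd_two_mul_add_one _)]
      exact inv_ne_zero (Real.log_pos (by
        have : (0 : ℝ) ≤ N (2 * Nat.pair n 0 + 1) := Nat.cast_nonneg _
        linarith)).ne'
  set g := wave he with hg
  set W := blockProportional ν g with hW
  -- The right endpoint already belongs to the next block; it is harmless because waves vanish at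
  -- integers.
  have hfl (k : ℕ) (t : ℝ) (ht : t ∈ Icc (N k : ℝ) (N (k + 1))) :
      t = N (k + 1) ∨ κ ⌊t⌋₊ = k := by
    refine ht.2.eq_or_lt.imp_right fun h => ?_
    have h0 : 0 ≤ t := (Nat.cast_nonneg _).trans ht.1
    exact hκ _ _ (Nat.le_floor ht.1) ((Nat.floor_lt h0).2 h)
  have hgz (n : ℕ) : onReal g n = 0 := by
    rw [onReal_wave he (Nat.cast_nonneg _), waveFun_natCast]
  -- Every fibre of `ν` contains a point where `g ≠ 0`, so proportionality forces `w` to vanish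
  -- wherever `g` does, in particular on even blocks.
  have hWz : ∀ w ∈ W, ∀ x : ℝ, 0 ≤ x → onReal g x = 0 → onReal w x = 0 := by
    intro w hw x hx hgx
    obtain ⟨j, hj1, hj2⟩ := hνe (ν ⌊x⌋₊)
    have hj : (0 : ℝ) ≤ j + 1 / 4 := by positivity
    have hfj : ⌊(j : ℝ) + 1 / 4⌋₊ = j :=
      (Nat.floor_eq_iff hj).2 ⟨by linarith, by linarith⟩
    have h1 := hw x (j + 1 / 4) hx hj (by rw [hfj, hj1])
    rw [hgx, mul_zero, onReal_wave he hj, waveFun_add_quarter] at h1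
    exact (mul_eq_zero.1 h1).resolve_right hj2
  have hgeven (k : ℕ) (hk : Even k) (t : ℝ) (ht : t ∈ Icc (N k : ℝ) (N (k + 1))) :
      onReal g t = 0 := by
    rcases hfl k t ht with rfl | h
    · exact hgz _
    · rw [onReal_wave he ((Nat.cast_nonneg _).trans ht.1), waveFun]
      simp [e, h, Nat.not_odd_iff_even.2 hk]
  have hgodd (k : ℕ) (hk : Odd k) (t : ℝ) (ht : t ∈ Icc (N k : ℝ) (N (k + 1))) :
      onReal g t = onReal g₀ t := by
    have h0 : 0 ≤ t := (Nat.cast_nonneg _).trans ht.1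
    rcases hfl k t ht with rfl | h
    · rw [hgz, onReal_wave _ h0, waveFun_natCast]
    · rw [onReal_wave he h0, onReal_wave _ h0, waveFun, waveFun]
      simp [e, h, hk]
  have hle (k : ℕ) : (N k : ℝ) ≤ N (k + 1) := by exact_mod_cast (hN (Nat.lt_succ_self k)).le
  have hWA : ∀ w ∈ W, w ≠ 0 → w ∈ noLp := by
    intro w hw hw0
    obtain ⟨x, hx, hwx⟩ : ∃ x : ℝ, 0 ≤ x ∧ onReal w x ≠ 0 := by
      by_contra! h
      exact hw0 (ext_onReal fun t ht => by rw [h t ht]; simp [onReal])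
    have hgx : onReal g x ≠ 0 := fun h => hwx (hWz w hw x hx h)
    set c := onReal g x / onReal w x with hc
    have hc0 : c ≠ 0 := div_ne_zero hgx hwx
    suffices c • w ∈ noLp by
      have h := smul_mem_noLp (inv_ne_zero hc0) this
      rwa [smul_smul, inv_mul_cancel₀ hc0, one_smul] at h
    have hφ : Tendsto (fun m => 2 * Nat.pair (ν ⌊x⌋₊) m + 1) atTop atTop :=
      tendsto_atTop_mono (fun m => by have := Nat.right_le_pair (ν ⌊x⌋₊) m; simp only [id]; omega) tendsto_id
    refine mem_noLp_of_frequently hN (hφ.frequently (Frequently.of_forall fun m => ?_))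
    set k := 2 * Nat.pair (ν ⌊x⌋₊) m + 1 with hk
    have hkodd : Odd k := odd_two_mul_add_one _
    have heq (t : ℝ) (ht : t ∈ Icc (N k : ℝ) (N (k + 1))) :
        onReal (c • w) t = onReal g₀ t := by
      have h0 : 0 ≤ t := (Nat.cast_nonneg _).trans ht.1
      rw [← hgodd k hkodd t ht, onReal_smul]
      rcases hfl k t ht with rfl | h
      · rw [hgz, hWz w hw _ h0 (hgz _), mul_zero]
      · have h1 := hw x t hx h0 (by
          simp only [ν]
          rw [h, hk, show (2 * Nat.pair (ν ⌊x⌋₊) m + 1) / 2 = Nat.pair (ν ⌊x⌋₊) m by omega,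
            Nat.unpair_pair])
        rw [hc]
        field_simp
        linarith
    refine ⟨fun t ht => ?_, ?_⟩
    · rw [heq t ht]
      exact abs_onReal_wave_inv_log_le ((Nat.cast_nonneg _).trans ht.1)
    · refine (hNK k g₀ (Or.inr rfl)).trans_eq (intervalIntegral.integral_congr fun t ht => ?_)
      rw [uIcc_of_le (hle k)] at ht
      simp only [heq t ht]
  have hFWA : ∀ f ∈ F, f ≠ 0 → ∀ w ∈ W, f + w ∈ noLp := by
    intro f hf hf0 w hw
    have hn : ‖f‖ ≠ 0 := norm_ne_zero_iff.2 hf0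
    suffices ‖f‖⁻¹ • (f + w) ∈ noLp by
      have h := smul_mem_noLp hn this
      rwa [smul_smul, mul_inv_cancel₀ hn, one_smul] at h
    have hn1 : ‖‖f‖⁻¹ • f‖ = 1 := norm_smul_inv_norm hf0
    have hfK : ‖f‖⁻¹ • f ∈ F.subtype '' Metric.sphere 0 1 ∪ {g₀} :=
      Or.inl ⟨⟨‖f‖⁻¹ • f, F.smul_mem _ hf⟩, by simpa using hn1, rfl⟩
    have hφ : Tendsto (fun m => 2 * m) atTop atTop :=
      tendsto_atTop_mono (fun m => by simp only [id]; omega) tendsto_id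
    refine mem_noLp_of_frequently hN (hφ.frequently (Frequently.of_forall fun m => ?_))
    have heq (t : ℝ) (ht : t ∈ Icc (N (2 * m) : ℝ) (N (2 * m + 1))) :
        onReal (‖f‖⁻¹ • (f + w)) t = onReal (‖f‖⁻¹ • f) t := by
      rw [onReal_smul, onReal_smul, onReal_add, hWz w hw t ((Nat.cast_nonneg _).trans ht.1)
        (hgeven _ (even_two_mul m) t ht), add_zero]
    refine ⟨fun t ht => ?_, ?_⟩
    · rw [heq t ht]
      exact (abs_onReal_le_norm _ t).trans_eq hn1
    · refine (hNK _ _ hfK).trans_eq (intervalIntegral.integral_congr fun t ht => ?_)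
      rw [uIcc_of_le (hle _)] at ht
      simp only [heq t ht]
  refine ⟨W ⊔ F, Submodule.isClosed_sup_finiteDimensional _ _ (isClosed_blockProportional ν g),
    (continuum_le_rank_blockProportional he hνe).trans (Submodule.rank_mono le_sup_left),
    le_sup_right, fun v hv => ?_⟩
  obtain ⟨w, hw, f, hf, rfl⟩ := Submodule.mem_sup.1 hv
  by_cases hf0 : f = 0
  · subst hf0
    rw [add_zero]
    by_cases hw0 : w = 0
    · exact Or.inr hw0
    · exact Or.inl (hWA w hw hw0)
  · rw [add_comm]
    exact Or.inl (hFWA f hf hf0 w hw)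

/-! ### Perturbing an infinite-dimensional space. -/

theorem tendsto_single : Tendsto (Pi.single 0 1 : ℕ → ℝ) atTop (𝓝 0) :=
  tendsto_const_nhds.congr' (by
    filter_upwards [eventually_gt_atTop 0] with n hn
    rw [Pi.single_eq_of_ne hn.ne'])

theorem wave_single_mem_memLp {p : ℝ} (hp : 0 < p) : wave tendsto_single ∈ memLp p := by
  rw [wave_mem_memLp_iff _ hp]
  refine summable_of_ne_finset_zero (s := {0}) fun n hn => ?_
  rw [Pi.single_eq_of_ne (by simpa using hn), abs_zero, Real.zero_rpow hp.ne']

theorem wave_single_ne_zero : wave tendsto_single ≠ 0 := by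
  intro h
  have h1 := onReal_wave tendsto_single (t := (0 : ℕ) + 1 / 4) (by positivity)
  rw [waveFun_add_quarter, h] at h1
  simp [onReal] at h1

/-- An infinite-dimensional space carries a linear functional taking the value one along a
sequence that tends to zero. -/
theorem exists_functional_seq {E : Type*} [NormedAddCommGroup E] [NormedSpace ℝ E]
    (h : Cardinal.aleph0 ≤ Module.rank ℝ E) :
    ∃ (l : E →ₗ[ℝ] ℝ) (x : ℕ → E), Tendsto x atTop (𝓝 0) ∧ ∀ n, l (x n) = 1 := by
  let b := Module.Basis.ofVectorSpace ℝ E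
  have : Infinite (Module.Basis.ofVectorSpaceIndex ℝ E) := by
    rwa [Cardinal.infinite_iff, b.mk_eq_rank'']
  let φ := Infinite.natEmbedding (Module.Basis.ofVectorSpaceIndex ℝ E)
  -- These values make the vectors normalised by `l` have norm 1/(n+1).
  let l := b.constr ℝ (Function.extend φ (fun n : ℕ => ((n : ℝ) + 1) * ‖b (φ n)‖) 0)
  have hl (n : ℕ) : l (b (φ n)) = ((n : ℝ) + 1) * ‖b (φ n)‖ := by
    rw [Module.Basis.constr_basis, φ.injective.extend_apply]
  have hb (n : ℕ) : ‖b (φ n)‖ ≠ 0 := norm_ne_zero_iff.2 (b.ne_zero _)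
  refine ⟨l, fun n => (((n : ℝ) + 1) * ‖b (φ n)‖)⁻¹ • b (φ n), ?_, fun n => ?_⟩
  · refine squeeze_zero_norm (fun n => le_of_eq ?_)
      (tendsto_one_div_add_atTop_nhds_zero_nat (𝕜 := ℝ))
    have := hb n
    rw [norm_smul, norm_inv, Real.norm_of_nonneg (by positivity)]
    field_simp
  · have := hb n
    rw [map_smul, hl, smul_eq_mul, inv_mul_cancel₀ (by positivity)]

/-- Every infinite-dimensional space of functions in no `L_p` can be perturbed to one of the same
dimension that lies in no closed such space. -/
theorem exists_perturbation (F : Submodule ℝ C0R) (hF : (F : Set C0R) \ {0} ⊆ noLp)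
    (hinf : Cardinal.aleph0 ≤ Module.rank ℝ F) :
    ∃ F' : Submodule ℝ C0R, Module.rank ℝ F' = Module.rank ℝ F ∧ (F' : Set C0R) ⊆ noLp ∪ {0} ∧
      ∀ G : Submodule ℝ C0R, IsClosed (G : Set C0R) → F' ≤ G → ¬(G : Set C0R) ⊆ noLp ∪ {0} := by
  obtain ⟨l, x, hx, hlx⟩ := exists_functional_seq hinf
  set φ := wave tendsto_single
  let T : F →ₗ[ℝ] C0R := F.subtype + l.smulRight φ
  have hT (y : F) : T y = y + l y • φ := rfl
  have hTA (y : F) (hy : y ≠ 0) : T y ∈ noLp := by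
    rw [mem_noLp]
    intro p hp h
    -- Subtracting the multiple of `φ`, which is in every `L_p`, would put `y` itself in `L_p`.
    have h1 := sub_mem_memLp h (smul_mem_memLp (l y) (wave_single_mem_memLp hp))
    rw [hT, add_sub_cancel_right] at h1
    exact mem_noLp.1 (hF ⟨y.2, fun h => hy (Subtype.ext h)⟩) p hp h1
  have hTinj : Function.Injective T := by
    rw [← LinearMap.ker_eq_bot, LinearMap.ker_eq_bot']
    intro y hy
    by_contra hy0
    refine mem_noLp.1 (hTA y hy0) 1 one_pos ?_
    rw [hy, ← zero_smul ℝ φ]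
    exact smul_mem_memLp 0 (wave_single_mem_memLp one_pos)
  refine ⟨LinearMap.range T, rank_range_of_injective T hTinj, ?_, fun G hG hle hGA => ?_⟩
  · rintro _ ⟨y, rfl⟩
    by_cases hy : y = 0
    · right
      simp [hy]
    · exact Or.inl (hTA y hy)
  · have hlim : Tendsto (fun n => T (x n)) atTop (𝓝 φ) := by
      have h1 : Tendsto (fun n => (x n : C0R) + φ) atTop (𝓝 ((0 : F) + φ)) :=
        ((F.subtypeL.continuous.tendsto 0).comp hx).add_const φ
      simpa [hT, hlx] using h1
    have hφ : φ ∈ G := hG.mem_of_tendsto hlim (Eventually.of_forall fun n => hle ⟨x n, rfl⟩)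
    rcases hGA hφ with h | h
    · exact mem_noLp.1 h 1 one_pos (wave_single_mem_memLp one_pos)
    · exact wave_single_ne_zero h

end C0R
end

theorem mainTheorem8 (α : Cardinal.{0}) :
    IsSpaceable ℝ α Cardinal.continuum ((univ : Set C0R) \ ⋃ p ∈ Ioi (0 : ℝ), C0R.memLp p) ↔
      α < Cardinal.aleph0 := by
  change IsSpaceable ℝ α Cardinal.continuum C0R.noLp ↔ _
  constructor
  · rintro ⟨⟨F, rfl, hF⟩, h⟩
    by_contra! hinf
    obtain ⟨F', h1, h2, h3⟩ := C0R.exists_perturbation F hF hinf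
    obtain ⟨G, hG, -, hle, hGA⟩ := h F' h1 h2
    exact h3 G hG hle hGA
  · intro hα
    refine ⟨?_, fun F hr hF => ?_⟩
    · obtain ⟨G, -, hG, -, hGA⟩ := C0R.exists_isClosed_extension ⊥ (by simp)
      obtain ⟨F, hle, hF⟩ := exists_submodule_rank_eq G
        (hα.le.trans (Cardinal.aleph0_le_continuum.trans hG))
      exact ⟨F, hF, fun f hf => (hGA (hle hf.1)).resolve_right hf.2⟩
    · have : FiniteDimensional ℝ F := Module.rank_lt_aleph0_iff.1 (hr ▸ hα)
      obtain ⟨G, h1, h2, h3, h4⟩ := C0R.exists_isClosed_extension F hF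
      exact ⟨G, h1, le_antisymm ((Submodule.rank_le G).trans C0R.rank_le_continuum) h2, h3, h4⟩
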